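/- **Setting.** Let $C,r,N$ be integers with $1\le r\le C$, $N\ge 0$. A server holds a library $W=(W_1,\dots,W_N)$ of $N$ files of $F$ bits each. There are $C$ caches and $K=\binom{C}{r}$ users, one user $U_g$ for every $r$-subset $g\subseteq[C]$; $U_g$ has access to the caches in $g$. For $0\le k\le C$ let $\Omega_k$ be the set of $k$-subsets of $[C]$. A *scheme* consists of a randomness $P$, uniform on a finite set, cache functions $Z_c=\psi_c(P,W)$ ($c\in[C]$) and a delivery function $X=\phi(P,(\mathbf d_g)_{g\in\Omega_r},W)$ whose values are bit strings of fixed lengths; $\mathbf d_g\in\mathbb F_2^N$ is the demand vector of $U_g$, who wants $B_g=\sum_n d_{g,n}W_n$. Put $Z_g=(Z_c)_{c\in g}$. The library, $P$ and the demands are independent, the demands of different users are mutually independent, and the library and each demand may have any law. The scheme is a *(demand-)private linear function retrieval (P-LFR) scheme* if, for all such laws and all $g\in\Omega_r$, $$H(B_g\mid X,\mathbf d_g,Z_g)=0,\qquad I\big((\mathbf d_h)_{h\ne g};\,X,\mathbf d_g,Z_g\big)=0 .$$ Let $l$ be the smallest positive integer with $r<2^l$, and for integers $0\le t\le C-r$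 and $F\geq 1$ let $$M_t^{(F)}=\frac{Nt}{C}+\binom{C-r}{t}\binom{C-1}{r-1}\left\lceil\frac{F}{l\binom Ct}\right\rceil\frac lF,\qquad R_t=\frac{\binom{C}{t+r}}{\binom Ct}.$$ **The SP-LFR scheme** (for $0\le t\le C-r$ and $F=\binom Ct B$ with $B\ge1$). Split every file into $\binom Ct$ subfiles $W_{n,T}$, $T\in\Omega_t$, of $B$ bits. Draw, independently and uniformly, security keys $V_S\in\mathbb F_2^B$ ($S\in\Omega_{t+r}$) and vectors $\mathbf P_g\in\mathbb F_2^N$ ($g\in\Omega_r$). For $g\in\Omega_r$, $T\in\Omega_t$ with $g\cap T=\emptyset$ put $K_{g,T}=\sum_n p_{g,n}W_{n,T}$ and $D_{g,T}=K_{g,T}+V_{g\cup T}$. Pad $D_{g,T}$ with zeros, cut it into $\lceil B/l\rceil$ blocks of $l$ bits, identify the blocks with elements of $\mathbb F_{2^l}$ by a fixed bijection $\mathbb F_2^l\to\mathbb F_{2^l}$, and replace every such element $s$ by the $r$ Shamir shares $s+\sum_{k=1}^{r-1}a_kx_j^k$ ($j\in[r]$), with fixed distinct nonzero points $x_1,\dots,x_r\in\mathbb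 F_{2^l}$ and fresh independent uniform coefficients $a_1,\dots,a_{r-1}\in\mathbb F_{2^l}$; this gives shares $D^1_{g,T},\dots,D^r_{g,T}$. Cache $c$ stores all $W_{n,T}$ with $c\in T$, and $D^{j}_{g,T}$ for all disjoint $g,T$ with $c\in g$, where $c$ is the $j$-th element of $g$. The server sends $\mathbf q_g=\mathbf d_g+\mathbf P_g$ for all $g\in\Omega_r$ and, for all $S\in\Omega_{t+r}$, $$Y_S=V_S+\sum_{g\subseteq S,\,|g|=r}\big(B_{g,S\setminus g}+K_{g,S\setminus g}\big),\qquad B_{g,T}=\sum_n d_{g,n}W_{n,T}.$$ **Theorem 2 (P-LFR scheme).** 1. For every $0\le t\le C-r$, $B\ge1$, $F=\binom CtB$, every bijection $\mathbb F_2^l\to\mathbb F_{2^l}$ and all distinct nonzero $x_1,\dots,x_r\in\mathbb F_{2^l}$, removing the security keys from the SP-LFR scheme (i.e. setting all $V_S=0$) gives a P-LFR scheme with subpacketization $\binom Ct$. Each cache has exactly $M_t^{(F)}F$ bits, and the signal has exactly $R_tF+KN$ bits (the $KN$ bits are the vectors $\mathbf q_g$, whose length is negligible compared to $F$). 2. P-LFR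 schemes achieve the lower convex envelope of the memory-rate pairs $$\{(0,N)\}\cup\{(M_t^{(F)},R_t):0\le t\le C-r\}\cup\{(N,0)\},$$ up to a number of transmitted bits that does not depend on $F$. That is, there is a constant $\kappa$, depending only on $C,r,N$, such that for every $F\ge1$ and every $M$ for which the convex hull $\mathcal H_F\subset\mathbb R^2$ of these points contains a point with first coordinate $M$, there is a P-LFR scheme for files of $F$ bits in which each cache has at most $MF$ bits and the signal has at most $RF+\kappa$ bits, where $R=\inf\{R':(M,R')\in\mathcal H_F\}$. -/

import Mathlib

noncomputable section

namespace MultiAccess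

/-! ### Entropy of finite-valued random variables -/

/-- Shannon entropy `H(X)`, in bits, of a finite-valued random variable `X` on `(Ω, p)`. -/
def entropy {Ω α : Type} [Finite α] (p : PMF Ω) (X : Ω → α) : ℝ :=
  ∑' a : α, Real.negMulLog ((p.map X) a).toReal / Real.log 2

/-- Conditional entropy `H(X | Y) = H(X, Y) - H(Y)`. -/
def condEntropy {Ω α β : Type} [Finite α] [Finite β] (p : PMF Ω) (X : Ω → α) (Y : Ω → β) : ℝ :=
  entropy p (fun ω => (X ω, Y ω)) - entropy p Y

/-- Mutual information `I(X; Y) = H(X) - H(X | Y)`. -/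
def mutualInfo {Ω α β : Type} [Finite α] [Finite β] (p : PMF Ω) (X : Ω → α) (Y : Ω → β) : ℝ :=
  entropy p X - condEntropy p X Y

/-! ### The network and its coded caching schemes -/

/-- The `k`-element subsets of the set of `C` caches. The users are `Sub C r`: one user for
each `r`-subset of caches, having access to exactly these caches. -/
abbrev Sub (C k : ℕ) : Type := {g : Finset (Fin C) // g.card = k}

/-- A library of `N` binary files; the bits of a file are indexed by `β`. -/
abbrev Library (N : ℕ) (β : Type) : Type := Fin N → β → ZMod 2

/-- The demand vectors of all users. -/
abbrev Demands (C r N : ℕ) : Type := Sub C r → Fin N → ZMod 2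

/-- The linear combination `a 1 * W 1 + ... + a N * W N` of the files. -/
def linComb {N : ℕ} {β : Type} (a : Fin N → ZMod 2) (W : Library N β) : β → ZMod 2 :=
  fun b => ∑ n, a n * W n b

/-- A scheme for `C` caches, access degree `r` and `N` files with bits indexed by `β`: the finite
set in which the private randomness of the server takes its values, the cache functions and the
delivery function. Cache `c` holds a string of `Nat.card (CacheIx c)` bits, and the transmitted
signal is a string of `Nat.card SendIx` bits. -/
structure Scheme (C r N : ℕ) (β : Type) where
  Rand : Type
  CacheIx : Fin C → Type
  SendIx : Type
  finite_rand : Finite Rand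
  nonempty_rand : Nonempty Rand
  finite_cacheIx : ∀ c, Finite (CacheIx c)
  finite_sendIx : Finite SendIx
  place : ∀ c, Rand → Library N β → CacheIx c → ZMod 2
  send : Rand → Demands C r N → Library N β → SendIx → ZMod 2

namespace Scheme

attribute [instance] finite_rand nonempty_rand finite_cacheIx finite_sendIx

variable {C r N : ℕ} {β : Type} (s : Scheme C r N β)

/-- The outcomes: library, randomness of the server, demands. -/
abbrev Outcome : Type := Library N β × s.Rand × Demands C r N

/-- The joint law of the library, the randomness of the server and the demands: they are
independent, and the randomness is uniform. -/
def law (pW : PMF (Library N β)) (pd : PMF (Demands C r N)) : PMF s.Outcome :=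
  letI : Fintype s.Rand := Fintype.ofFinite _
  pW.bind fun W => (PMF.uniformOfFintype s.Rand).bind fun ρ => pd.map fun d => (W, ρ, d)

/-- The transmitted signal `X`. -/
def signal (ω : s.Outcome) : s.SendIx → ZMod 2 := s.send ω.2.1 ω.2.2 ω.1

/-- The content `Z_g` of all caches which user `g` has access to. -/
def cached (g : Sub C r) (ω : s.Outcome) : ∀ c : {c // c ∈ g.1}, s.CacheIx c.1 → ZMod 2 :=
  fun c => s.place c.1 ω.2.1 ω.1

/-- The demand vector `d_g` of user `g`. -/
def demand (g : Sub C r) (ω : s.Outcome) : Fin N → ZMod 2 := ω.2.2 g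

/-- The demand vectors of all users other than `g`. -/
def otherDemands (g : Sub C r) (ω : s.Outcome) : {h : Sub C r // h ≠ g} → Fin N → ZMod 2 :=
  fun h => ω.2.2 h.1

/-- The linear combination `B_g` of the files which user `g` demands. -/
def wanted (g : Sub C r) (ω : s.Outcome) : β → ZMod 2 := linComb (ω.2.2 g) ω.1

end Scheme

/-- The demand vectors of the different users are mutually independent under `pd`. -/
def IndepDemands {C r N : ℕ} (pd : PMF (Demands C r N)) : Prop :=
  ∃ q : Sub C r → PMF (Fin N → ZMod 2), ∀ d, pd d = ∏ g, q g (d g)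

/-- Correctness `H(B_g | X, d_g, Z_g) = 0` for every user `g`. -/
def Scheme.Correct {C r N : ℕ} {β : Type} [Finite β] (s : Scheme C r N β) : Prop :=
  ∀ (pW : PMF (Library N β)) (pd : PMF (Demands C r N)), IndepDemands pd → ∀ g : Sub C r,
    condEntropy (s.law pW pd) (s.wanted g) (fun ω => (s.signal ω, s.demand g ω, s.cached g ω)) = 0

/-- Demand privacy `I(d_{others}; X, d_g, Z_g) = 0` for every user `g`. -/
def Scheme.DemandPrivate {C r N : ℕ} {β : Type} [Finite β] (s : Scheme C r N β) : Prop :=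
  ∀ (pW : PMF (Library N β)) (pd : PMF (Demands C r N)), IndepDemands pd → ∀ g : Sub C r,
    mutualInfo (s.law pW pd) (s.otherDemands g)
      (fun ω => (s.signal ω, s.demand g ω, s.cached g ω)) = 0

/-- A private linear function retrieval (P-LFR) scheme. -/
def Scheme.IsPLFR {C r N : ℕ} {β : Type} [Finite β] (s : Scheme C r N β) : Prop :=
  s.Correct ∧ s.DemandPrivate

/-! ### The SP-LFR scheme, and the scheme without its security keys -/

/-- The smallest positive integer `l` with `r < 2 ^ l`. -/
def symBits (r : ℕ) : ℕ := sInf {l : ℕ | 0 < l ∧ r < 2 ^ l}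

/-- The field with `2 ^ l` elements, `l = symBits r`. -/
abbrev ShareField (r : ℕ) : Type := GaloisField 2 (symBits r)

/-- The pairs of a user `g` and a disjoint `t`-subset `T` of the caches. -/
abbrev KeyIx (C r t : ℕ) : Type := {q : Sub C r × Sub C t // Disjoint q.1.1 q.2.1}

/-- `g ∪ T` for disjoint `g` and `T`. -/
def KeyIx.union {C r t : ℕ} (q : KeyIx C r t) : Sub C (t + r) :=
  ⟨q.1.1.1 ∪ q.1.2.1, by
    rw [Finset.card_union_of_disjoint q.2, q.1.1.2, q.1.2.2, Nat.add_comm]⟩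

/-- The position of `c` among the elements of `g`, in increasing order. -/
def position {C r : ℕ} (g : Sub C r) (c : Fin C) (hc : c ∈ g.1) : Fin r :=
  (g.1.orderIsoOfFin g.2).symm ⟨c, hc⟩

/-- The `m`-th block of `l` bits of a string of `B` bits, padded with zeros at the end. -/
def block {B : ℕ} (l : ℕ) (D : Fin B → ZMod 2) (m : ℕ) : Fin l → ZMod 2 :=
  fun k => if h : m * l + k < B then D ⟨m * l + k, h⟩ else 0

/-- Shamir's share of the secret `s`: the value at `x` of the polynomial
`s + a 0 * X + ... + a (r - 2) * X ^ (r - 1)`. -/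
def shamirShare {L : Type} [Field L] {r : ℕ} (s : L) (a : Fin (r - 1) → L) (x : L) : L :=
  s + ∑ k, a k * x ^ ((k : ℕ) + 1)

/-- The security keys: independent uniform strings of `B` bits, one for each `(t+r)`-subset. -/
abbrev SecurityKeys (C r t B : ℕ) : Type := Sub C (t + r) → Fin B → ZMod 2

/-- The other randomness of the scheme: a uniform vector `P_g` for each user `g`, and the random
coefficients for secret sharing, for each key and each of the `⌈B / l⌉` symbols of the key. -/
abbrev PrivacyRand (C r N t B : ℕ) : Type :=
  (Sub C r → Fin N → ZMod 2) ×
    (KeyIx C r t → Fin (B ⌈/⌉ symBits r) → Fin (r - 1) → ShareField r)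

/-- The SP-LFR scheme. Each file consists of `C.choose t` subfiles of `B` bits, indexed by the
`t`-subsets of the caches. The elements of the field with `2 ^ l` elements are written with `l`
bits through `e`, and the `r` shares are the values of the polynomials at `x 0, ..., x (r-1)`. -/
def spLFR (C r N t B : ℕ) (e : (Fin (symBits r) → ZMod 2) ≃ ShareField r)
    (x : Fin r → ShareField r) : Scheme C r N (Sub C t × Fin B) where
  Rand := SecurityKeys C r t B × PrivacyRand C r N t B
  CacheIx c :=
    (Fin N × {T : Sub C t // c ∈ T.1} × Fin B) ⊕
      ({q : KeyIx C r t // c ∈ q.1.1.1} × Fin (B ⌈/⌉ symBits r) × Fin (symBits r))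
  SendIx := (Sub C (t + r) × Fin B) ⊕ (Sub C r × Fin N)
  finite_rand := inferInstance
  nonempty_rand := inferInstance
  finite_cacheIx := inferInstance
  finite_sendIx := inferInstance
  place c := fun (V, P, a) W => Sum.elim
    (fun (n, T, b) => W n (T.1, b))
    (fun (q, m, k) =>
      let D : Fin B → ZMod 2 := fun b => linComb (P q.1.1.1) W (q.1.1.2, b) + V q.1.union b
      e.symm (shamirShare (e (block (symBits r) D m)) (a q.1 m)
        (x (position q.1.1.1 c q.2))) k)
  send := fun (V, P, _) d W => Sum.elim
    (fun (S, b) => V S b + ∑ g : Sub C r, ∑ T : Sub C t,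
      if g.1 ⊆ S.1 ∧ T.1 = S.1 \ g.1 then
        linComb (d g) W (T, b) + linComb (P g) W (T, b) else 0)
    (fun (g, n) => d g n + P g n)

/-- The P-LFR scheme: the SP-LFR scheme without security keys, that is, with all of them replaced
by zero. -/
def pLFR (C r N t B : ℕ) (e : (Fin (symBits r) → ZMod 2) ≃ ShareField r)
    (x : Fin r → ShareField r) : Scheme C r N (Sub C t × Fin B) where
  Rand := PrivacyRand C r N t B
  CacheIx := (spLFR C r N t B e x).CacheIx
  SendIx := (spLFR C r N t B e x).SendIx
  finite_rand := inferInstance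
  nonempty_rand := inferInstance
  finite_cacheIx := inferInstance
  finite_sendIx := inferInstance
  place c ρ W := (spLFR C r N t B e x).place c (0, ρ) W
  send ρ d W := (spLFR C r N t B e x).send (0, ρ) d W

/-! ### Memory-rate pairs -/

/-- The cache size, in files of `F` bits. -/
def memP (C r N F t : ℕ) : ℝ :=
  (N : ℝ) * t / C + ((C - r).choose t : ℝ) * ((C - 1).choose (r - 1) : ℝ) *
    (⌈(F : ℝ) / ((symBits r : ℝ) * (C.choose t : ℝ))⌉₊ : ℝ) * ((symBits r : ℝ) / F)

/-- The rate, in files. -/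
def rateP (C r t : ℕ) : ℝ := (C.choose (t + r) : ℝ) / (C.choose t : ℝ)

/-- The corner points `(0, N)`, `(memP t, rateP t)` for `0 ≤ t ≤ C - r`, and `(N, 0)`. -/
def cornerPoints (C r N F : ℕ) : Set (ℝ × ℝ) :=
  {((0 : ℝ), (N : ℝ))} ∪ {p | ∃ t : ℕ, t + r ≤ C ∧ p = (memP C r N F t, rateP C r t)} ∪
    {((N : ℝ), (0 : ℝ))}

/-- The lower convex envelope of a set of points of the plane, as a function on the projection of
the convex hull to the first coordinate. -/
def lowerConvexEnvelope (S : Set (ℝ × ℝ)) (M : ℝ) : ℝ :=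
  sInf {R : ℝ | (M, R) ∈ convexHull ℝ S}

end MultiAccess

end

noncomputable section

namespace MultiAccess

/-! ### Entropy of determined and of independent random variables -/

/-! Both information-theoretic conditions reduce to statements free of probability. Correctness
holds under every law once the wanted combination is a function of what the user sees (`Decodable`).
Privacy holds once, for a fixed library and a fixed own demand, any change of the other demands can
be undone by a permutation of the server's randomness that leaves the user's view unchanged
(`Masked`): this randomness is uniform, so the law of the view does not depend on the other demands.

Decoding (`pLFR_decodable`): user g reads all r shares of each of its keys, so it knows the keys. In
the signal of S = g ∪ T every term of another user h involves a subfile S \ h that meets g and hence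
is cached; only the wanted subfile plus a known key remains. Privacy (`pLFR_masked`): translating P
by d - d' fixes all d + P. The keys of other users change, but user g sees at most r - 1 shares of
each, and these are restored by moving the Shamir coefficients.

Both criteria survive memory sharing with independent randomness. A point of the convex hull is
therefore reached by giving each corner its weight's worth of bits, rounded down, and sending the
leftover bits uncoded (`exists_achievable_corner`, `achievable_of_mem_convexHull`). The loss is
bounded independently of F. -/

theorem map_apply_of_injective {Ω α β : Type} (p : PMF Ω) (Y : Ω → α) {i : α → β}
    (hi : Function.Injective i) (a : α) : (p.map (fun ω => i (Y ω))) (i a) = (p.map Y) a := by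
  classical
  simp only [PMF.map_apply, hi.eq_iff]

theorem map_apply_eq_zero_of_notMem_range {Ω α β : Type} (p : PMF Ω) (Y : Ω → α) {i : α → β}
    {b : β} (hb : b ∉ Set.range i) : (p.map (fun ω => i (Y ω))) b = 0 := by
  classical
  rw [PMF.map_apply, ENNReal.tsum_eq_zero]
  intro ω
  rw [if_neg]
  rintro rfl
  exact hb ⟨_, rfl⟩

theorem entropy_comp_of_injective {Ω α β : Type} [Finite α] [Finite β] (p : PMF Ω) (Y : Ω → α)
    {i : α → β} (hi : Function.Injective i) :
    entropy p (fun ω => i (Y ω)) = entropy p Y := by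
  unfold entropy
  rw [← hi.tsum_eq]
  · simp only [map_apply_of_injective p Y hi]
  · intro b hb
    by_contra h
    apply hb
    simp [map_apply_eq_zero_of_notMem_range p Y h]

/-- If X = f(Y), then (X, Y) is the image of Y under the injection b ↦ (f b, b), and injections
preserve entropy. -/
theorem condEntropy_eq_zero_of_determined {Ω α β : Type} [Finite α] [Finite β] (p : PMF Ω)
    {X : Ω → α} {Y : Ω → β} (h : ∀ ω ω', Y ω = Y ω' → X ω = X ω') : condEntropy p X Y = 0 := by
  obtain ⟨ω₀, -⟩ := p.support_nonempty
  -- The default `X ω₀` is used only off the range of Y and is never evaluated on an outcome.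
  obtain ⟨f, hf⟩ : ∃ f : β → α, X = fun ω => f (Y ω) :=
    ⟨Function.extend Y X fun _ => X ω₀, funext fun ω =>
      (Function.FactorsThrough.extend_apply (fun a b hab => h a b hab) _ ω).symm⟩
  subst hf
  rw [condEntropy, sub_eq_zero]
  exact entropy_comp_of_injective p Y (i := fun b => (f b, b))
    fun a b hab => (Prod.mk.inj hab).2

theorem map_fst_apply {Ω α β : Type} [Fintype β] (p : PMF Ω) (X : Ω → α) (Y : Ω → β) (a : α) :
    (p.map X) a = ∑ b, (p.map fun ω => (X ω, Y ω)) (a, b) := by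
  classical
  simp only [PMF.map_apply, Prod.mk.injEq, ← tsum_fintype (L := .unconditional _)]
  rw [ENNReal.tsum_comm]
  refine tsum_congr fun ω => ?_
  by_cases h : a = X ω
  · simp [h]
  · simp [h]

theorem map_snd_apply {Ω α β : Type} [Fintype α] (p : PMF Ω) (X : Ω → α) (Y : Ω → β) (b : β) :
    (p.map Y) b = ∑ a, (p.map fun ω => (X ω, Y ω)) (a, b) := by
  rw [map_fst_apply p Y X b]
  refine Finset.sum_congr rfl fun a _ => ?_
  exact (map_apply_of_injective p (fun ω => (X ω, Y ω)) (Prod.swap_injective) (a, b))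

/-- A joint law which is a product of a function of the first and a function of the second
variable is the product of the marginal laws. -/
theorem map_prod_apply_eq_mul {Ω α β : Type} [Finite α] [Finite β] (p : PMF Ω) (X : Ω → α)
    (Y : Ω → β) (f : α → ENNReal) (k : β → ENNReal)
    (h : ∀ a b, (p.map fun ω => (X ω, Y ω)) (a, b) = f a * k b) (a : α) (b : β) :
    (p.map fun ω => (X ω, Y ω)) (a, b) = (p.map X) a * (p.map Y) b := by
  cases nonempty_fintype α
  cases nonempty_fintype β
  have hX : ∀ a, (p.map X) a = f a * ∑ b, k b := fun a => by
    rw [map_fst_apply p X Y a, Finset.mul_sum]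
    exact Finset.sum_congr rfl fun b _ => h a b
  have hY : ∀ b, (p.map Y) b = (∑ a, f a) * k b := fun b => by
    rw [map_snd_apply p X Y b, Finset.sum_mul]
    exact Finset.sum_congr rfl fun a _ => h a b
  have h1 : (∑ a, f a) * ∑ b, k b = 1 := by
    rw [← (p.map X).tsum_coe, tsum_fintype, Finset.sum_mul]
    exact Finset.sum_congr rfl fun a _ => (hX a).symm
  rw [h, hX, hY]
  calc f a * k b = f a * k b * ((∑ a, f a) * ∑ b, k b) := by rw [h1, mul_one]
    _ = _ := by ring

theorem sum_toReal_pmf {α : Type} [Fintype α] (p : PMF α) : ∑ a, (p a).toReal = 1 := by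
  rw [← ENNReal.toReal_sum fun a _ => p.apply_ne_top a, ← tsum_fintype (L := .unconditional _),
    p.tsum_coe, ENNReal.toReal_one]

/-- The factors need not be normalised, so no marginal law has to be computed beforehand. Entropy is
additive on the resulting product law. -/
theorem mutualInfo_eq_zero_of_factorization {Ω α β : Type} [Finite α] [Finite β] (p : PMF Ω)
    (X : Ω → α) (Y : Ω → β) (f : α → ENNReal) (k : β → ENNReal)
    (h : ∀ a b, (p.map fun ω => (X ω, Y ω)) (a, b) = f a * k b) : mutualInfo p X Y = 0 := by
  cases nonempty_fintype α
  cases nonempty_fintype β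
  have hp := map_prod_apply_eq_mul p X Y f k h
  have key : entropy p (fun ω => (X ω, Y ω)) = entropy p X + entropy p Y := by
    unfold entropy
    simp only [tsum_fintype, Fintype.sum_prod_type, hp, ENNReal.toReal_mul, Real.negMulLog_mul,
      add_div, Finset.sum_add_distrib]
    congr 1
    · refine Finset.sum_congr rfl fun a _ => ?_
      simp only [mul_div_assoc]
      rw [← Finset.sum_mul, sum_toReal_pmf, one_mul]
    · rw [Finset.sum_comm]
      refine Finset.sum_congr rfl fun b _ => ?_
      simp only [mul_div_assoc]
      rw [← Finset.sum_mul, sum_toReal_pmf, one_mul]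
  unfold mutualInfo condEntropy
  rw [key]
  ring

/-! ### Combinatorial criteria for correctness and demand privacy -/

namespace Scheme

variable {C r N : ℕ} {β : Type}

/-- The linear combination demanded by a user is determined by what the user sees. -/
def Decodable (s : Scheme C r N β) : Prop :=
  ∀ (g : Sub C r) (W W' : Library N β) (ρ ρ' : s.Rand) (d d' : Demands C r N),
    s.send ρ d W = s.send ρ' d' W' → d g = d' g →
    (∀ c ∈ g.1, s.place c ρ W = s.place c ρ' W') → linComb (d g) W = linComb (d' g) W'

/-- A change of the demands of the other users can be compensated by a permutation of the
randomness which preserves what the user sees. -/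
def Masked (s : Scheme C r N β) : Prop :=
  ∀ (g : Sub C r) (W : Library N β) (d d' : Demands C r N), d g = d' g →
    ∃ σ : Equiv.Perm s.Rand, ∀ ρ, s.send (σ ρ) d' W = s.send ρ d W ∧
      ∀ c ∈ g.1, s.place c (σ ρ) W = s.place c ρ W

variable {s : Scheme C r N β}

theorem Decodable.correct [Finite β] (hs : s.Decodable) : s.Correct := by
  intro pW pd _ g
  refine condEntropy_eq_zero_of_determined _ ?_
  rintro ⟨W, ρ, d⟩ ⟨W', ρ', d'⟩ h
  simp only [Prod.mk.injEq] at h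
  exact hs g W W' ρ ρ' d d' h.1 h.2.1 fun c hc => congrFun h.2.2 ⟨c, hc⟩

/-- What user `g` sees. -/
abbrev observation (s : Scheme C r N β) (g : Sub C r) (ω : s.Outcome) :=
  (s.signal ω, s.demand g ω, s.cached g ω)

/-- Independence of the demands splits their law into the own factor `q g` and the factor `f` of the
others. The permutation reindexes the uniform sum over the randomness, so the view has the same law
for the actual other demands as for a fixed reference. -/
theorem Masked.demandPrivate [Finite β] (hs : s.Masked) : s.DemandPrivate := by
  classical
  intro pW pd hpd g
  obtain ⟨q, hq⟩ := hpd
  let : Fintype s.Rand := Fintype.ofFinite _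
  let E := Equiv.funSplitAt g (Fin N → ZMod 2)
  let glue (x : Fin N → ZMod 2) (a : {h : Sub C r // h ≠ g} → Fin N → ZMod 2) : Demands C r N :=
    E.symm (x, a)
  have glue_self : ∀ x a, glue x a g = x := fun x a => by simp [glue, E]
  have glue_other : ∀ x a (h : {h : Sub C r // h ≠ g}), glue x a h.1 = a h := fun x a h => by
    simp [glue, E, h.2]
  let f (a : {h : Sub C r // h ≠ g} → Fin N → ZMod 2) : ENNReal := ∏ h, q h.1 (a h)
  have hglue : ∀ x a, pd (glue x a) = q g x * f a := by
    intro x a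
    rw [hq, Fintype.prod_eq_mul_prod_subtype_ne _ g, glue_self]
    simp only [glue_other, f]
  let U := PMF.uniformOfFintype s.Rand
  -- The second factor is the law of the view when all other users demand the zero vector.
  refine mutualInfo_eq_zero_of_factorization _ _ _ f
    (fun o => ∑' W, pW W * ∑' x, q g x * ∑' ρ, U ρ *
      if o = s.observation g (W, ρ, glue x 0) then 1 else 0) ?_
  intro a o
  have step : ∀ W ρ, (pd.map fun d => (s.otherDemands g (W, ρ, d),
      s.observation g (W, ρ, d))) (a, o) =
      ∑' x, q g x * f a * if o = s.observation g (W, ρ, glue x a) then 1 else 0 := by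
    intro W ρ
    rw [PMF.map_apply, ← E.symm.tsum_eq, ENNReal.tsum_prod']
    refine tsum_congr fun x => ?_
    rw [tsum_eq_single a]
    · have : s.otherDemands g (W, ρ, glue x a) = a := funext fun h => glue_other x a h
      rw [show E.symm (x, a) = glue x a from rfl, this, hglue]
      simp
    · intro a' ha'
      rw [if_neg]
      intro h
      apply ha'
      have h' := (Prod.mk.inj h).1
      rw [h']
      exact (funext fun h => glue_other x a' h).symm
  have swap : ∀ W x, ∑' ρ, U ρ * (if o = s.observation g (W, ρ, glue x a) then 1 else 0) =
      ∑' ρ, U ρ * (if o = s.observation g (W, ρ, glue x 0) then (1 : ENNReal) else 0) := by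
    intro W x
    obtain ⟨σ, hσ⟩ := hs g W (glue x a) (glue x 0) (by rw [glue_self, glue_self])
    rw [← σ.tsum_eq (fun ρ => U ρ * (if o = s.observation g (W, ρ, glue x 0) then 1 else 0))]
    refine tsum_congr fun ρ => ?_
    have h1 : s.observation g (W, σ ρ, glue x 0) = s.observation g (W, ρ, glue x a) := by
      refine Prod.ext (hσ ρ).1 (Prod.ext ?_ (funext fun c => (hσ ρ).2 c.1 c.2))
      simp only [demand, glue_self]
    rw [h1]
    simp [U]
  calc ((s.law pW pd).map fun ω => (s.otherDemands g ω, s.observation g ω)) (a, o)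
      = ∑' W, pW W * ∑' ρ, U ρ * (pd.map fun d => (s.otherDemands g (W, ρ, d),
          s.observation g (W, ρ, d))) (a, o) := by
        simp only [law, PMF.map_bind, PMF.map_comp, PMF.bind_apply]
        rfl
    _ = ∑' W, pW W * ∑' ρ, U ρ *
          ∑' x, q g x * f a * if o = s.observation g (W, ρ, glue x a) then 1 else 0 := by
        simp only [step]
    _ = ∑' W, pW W * ∑' x, q g x * f a *
          ∑' ρ, U ρ * if o = s.observation g (W, ρ, glue x a) then 1 else 0 := by
        refine tsum_congr fun W => ?_
        congr 1
        simp only [← ENNReal.tsum_mul_left]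
        rw [ENNReal.tsum_comm]
        refine tsum_congr fun x => tsum_congr fun ρ => ?_
        ring
    _ = _ := by
        simp only [swap, ← ENNReal.tsum_mul_left]
        refine tsum_congr fun W => tsum_congr fun x => tsum_congr fun ρ => ?_
        ring

theorem isPLFR_of_decodable_of_masked [Finite β] (hd : s.Decodable) (hm : s.Masked) :
    s.IsPLFR :=
  ⟨hd.correct, hm.demandPrivate⟩

end Scheme

/-! ### Shamir's secret sharing -/

section Shamir

variable {L : Type} [Field L] {r : ℕ}

/-- Replacing the secret leaves intact every share taken at a zero of the polynomial with constant
term 1 and coefficients `c`. -/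
theorem shamirShare_add_mul (s s' : L) (a c : Fin (r - 1) → L) (x : L) :
    shamirShare s' (a + fun k => (s' - s) * c k) x =
      shamirShare s a x + (s' - s) * shamirShare 1 c x := by
  simp only [shamirShare, Pi.add_apply, mul_add, Finset.mul_sum, add_mul, Finset.sum_add_distrib,
    mul_assoc]
  ring

/-- All the shares together determine the secret. -/
theorem eq_of_shamirShare_eq (hr : 0 < r) {x : Fin r → L} (hx : Function.Injective x) {s s' : L}
    {a a' : Fin (r - 1) → L} (h : ∀ j, shamirShare s a (x j) = shamirShare s' a' (x j)) :
    s = s' := by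
  -- The difference of the two sharing polynomials has degree at most r - 1 and r distinct roots.
  let p : Polynomial L := Polynomial.C (s - s') +
    ∑ k, Polynomial.C (a k - a' k) * Polynomial.X ^ ((k : ℕ) + 1)
  have hp : p = 0 := by
    refine Polynomial.eq_zero_of_natDegree_lt_card_of_eval_eq_zero p hx (fun j => ?_) ?_
    · have hj := h j
      simp only [shamirShare] at hj
      simp only [p, Polynomial.eval_add, Polynomial.eval_C, Polynomial.eval_finsetSum,
        Polynomial.eval_mul, Polynomial.eval_pow, Polynomial.eval_X, sub_mul,
        Finset.sum_sub_distrib]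
      linear_combination hj
    · rw [Fintype.card_fin]
      refine lt_of_le_of_lt (Polynomial.natDegree_add_le_of_degree_le (n := r - 1) (by simp)
        (Polynomial.natDegree_sum_le_of_forall_le _ _ fun k _ => ?_)) (Nat.sub_lt hr one_pos)
      exact (Polynomial.natDegree_C_mul_X_pow_le _ _).trans (by have := k.2; omega)
  have h0 := congrArg (Polynomial.eval 0) hp
  simpa [p, Polynomial.eval_finsetSum, sub_eq_zero] using h0

/-- There is a polynomial of degree less than `r` with constant term one which vanishes at all
but one of `r` nonzero points. -/
theorem exists_shamirShare_one_eq_zero {x : Fin r → L} (hx : ∀ j, x j ≠ 0) (j₀ : Fin r) :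
    ∃ c : Fin (r - 1) → L, ∀ j, j ≠ j₀ → shamirShare 1 c (x j) = 0 := by
  classical
  let p : Polynomial L := ∏ j ∈ Finset.univ.erase j₀,
    (1 - Polynomial.C (x j)⁻¹ * Polynomial.X)
  have hdeg : p.natDegree < (r - 1) + 1 := by
    refine Nat.lt_succ_of_le ((Polynomial.natDegree_prod_le _ _).trans ?_)
    refine (Finset.sum_le_card_nsmul _ _ 1 fun j _ => ?_).trans (by simp)
    refine (Polynomial.natDegree_sub_le _ _).trans ?_
    simpa using (Polynomial.natDegree_C_mul_le (x j)⁻¹ Polynomial.X).trans Polynomial.natDegree_X_le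
  have h0 : p.coeff 0 = 1 := by
    simp [p, Polynomial.coeff_zero_eq_eval_zero, Polynomial.eval_prod]
  refine ⟨fun k => p.coeff (k + 1), fun j hj => ?_⟩
  have hev : p.eval (x j) = 0 := by
    rw [Polynomial.eval_prod]
    refine Finset.prod_eq_zero (Finset.mem_erase.2 ⟨hj, Finset.mem_univ j⟩) ?_
    simp [hx j]
  rw [Polynomial.eval_eq_sum_range' hdeg, Finset.sum_range_succ', h0] at hev
  rw [shamirShare, Fin.sum_univ_eq_sum_range (fun k => p.coeff (k + 1) * x j ^ (k + 1))]
  simpa [add_comm] using hev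

end Shamir

/-! ### Blocks, linear combinations and the symbol length -/

theorem block_injective {B l : ℕ} (hl : 0 < l) {D D' : Fin B → ZMod 2}
    (h : ∀ m : Fin (B ⌈/⌉ l), block l D m = block l D' m) : D = D' := by
  funext b
  have hm : b.1 / l < B ⌈/⌉ l := by
    rw [Nat.ceilDiv_eq_add_pred_div, Nat.div_lt_iff_lt_mul hl]
    have h1 := Nat.div_add_mod (B + l - 1) l
    have h2 := Nat.mod_lt (B + l - 1) hl
    have h3 := b.2
    rw [mul_comm] at h1
    omega
  have hb : b.1 / l * l + b.1 % l = b.1 := by rw [mul_comm]; exact Nat.div_add_mod _ _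
  have := congrFun (h ⟨_, hm⟩) ⟨b.1 % l, Nat.mod_lt _ hl⟩
  simpa [block, hb] using this

theorem linComb_add {N : ℕ} {β : Type} (a a' : Fin N → ZMod 2) (W : Library N β) (b : β) :
    linComb (a + a') W b = linComb a W b + linComb a' W b := by
  simp [linComb, add_mul, Finset.sum_add_distrib]

theorem linComb_congr {N : ℕ} {β : Type} (a : Fin N → ZMod 2) {W W' : Library N β} {b : β}
    (h : ∀ n, W n b = W' n b) : linComb a W b = linComb a W' b := by
  simp [linComb, h]

theorem symBits_spec (r : ℕ) : 0 < symBits r ∧ r < 2 ^ symBits r :=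
  Nat.sInf_mem (s := {l : ℕ | 0 < l ∧ r < 2 ^ l})
    ⟨r + 1, r.succ_pos, r.lt_two_pow_self.trans (Nat.pow_lt_pow_succ one_lt_two)⟩

/-! ### The P-LFR scheme -/

section PLFR

variable {C r N t B : ℕ} {e : (Fin (symBits r) → ZMod 2) ≃ ShareField r}
  {x : Fin r → ShareField r}

/-- The demands enter only through d + P, and a single sum over pairs lets the decoder isolate one
summand. -/
theorem pLFR_send_inl (ρ : (pLFR C r N t B e x).Rand) (d : Demands C r N)
    (W : Library N (Sub C t × Fin B)) (S : Sub C (t + r)) (b : Fin B) :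
    (pLFR C r N t B e x).send ρ d W (.inl (S, b)) = ∑ q : Sub C r × Sub C t,
      if q.1.1 ⊆ S.1 ∧ q.2.1 = S.1 \ q.1.1 then
        linComb (d q.1 + ρ.1 q.1) W (q.2, b) else 0 := by
  rw [Fintype.sum_prod_type]
  simp only [linComb_add]
  exact zero_add _

theorem pLFR_send_inr (ρ : (pLFR C r N t B e x).Rand) (d : Demands C r N)
    (W : Library N (Sub C t × Fin B)) (g : Sub C r) (n : Fin N) :
    (pLFR C r N t B e x).send ρ d W (.inr (g, n)) = (d g + ρ.1 g) n := rfl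

/-- The `m`-th symbol of the key of the pair `q`. -/
def keySymbol (e : (Fin (symBits r) → ZMod 2) ≃ ShareField r) (P : Sub C r → Fin N → ZMod 2)
    (W : Library N (Sub C t × Fin B)) (q : KeyIx C r t) (m : ℕ) : ShareField r :=
  e (block (symBits r) (fun b => linComb (P q.1.1) W (q.1.2, b)) m)

theorem pLFR_place_inr (ρ : (pLFR C r N t B e x).Rand) (W : Library N (Sub C t × Fin B))
    (c : Fin C) (q : {q : KeyIx C r t // c ∈ q.1.1.1}) (m : Fin (B ⌈/⌉ symBits r))
    (k : Fin (symBits r)) :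
    (pLFR C r N t B e x).place c ρ W (.inr (q, m, k)) =
      e.symm (shamirShare (keySymbol e ρ.1 W q.1 m) (ρ.2 q.1 m)
        (x (position q.1.1.1 c q.2))) k := by
  change e.symm (shamirShare (e (block (symBits r)
    (fun b => linComb (ρ.1 q.1.1.1) W (q.1.1.2, b) + 0) m)) _ _) k = _
  simp only [add_zero]
  rfl

theorem exists_position_eq (g : Sub C r) (j : Fin r) : ∃ c, ∃ hc : c ∈ g.1, position g c hc = j :=
  ⟨_, (g.1.orderIsoOfFin g.2 j).2, OrderIso.symm_apply_apply _ j⟩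

theorem position_injective (g : Sub C r) {c c' : Fin C} (hc : c ∈ g.1) (hc' : c' ∈ g.1)
    (h : position g c hc = position g c' hc') : c = c' := by
  simpa [position] using h

theorem pLFR_decodable (hr : 0 < r) (hx : Function.Injective x) :
    (pLFR C r N t B e x).Decodable := by
  classical
  intro g W W' ρ ρ' d d' hX hd hZ
  have hW : ∀ T : Sub C t, ¬ Disjoint g.1 T.1 → ∀ b n, W n (T, b) = W' n (T, b) := by
    intro T hT b n
    obtain ⟨c, hcg, hcT⟩ := Finset.not_disjoint_iff.1 hT
    exact congrFun (hZ c hcg) (.inl (n, ⟨T, hcT⟩, b))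
  have hq : ∀ h : Sub C r, d h + ρ.1 h = d' h + ρ'.1 h := fun h =>
    funext fun n => congrFun hX (.inr (h, n))
  have hkey : ∀ q : KeyIx C r t, q.1.1 = g → (fun b => linComb (ρ.1 q.1.1) W (q.1.2, b)) =
      fun b => linComb (ρ'.1 q.1.1) W' (q.1.2, b) := by
    intro q hqg
    refine block_injective (symBits_spec r).1 fun m => e.injective ?_
    -- Each of the r share positions belongs to a cache of g, so all shares of the own key are
    -- visible.
    refine eq_of_shamirShare_eq (a := ρ.2 q m) (a' := ρ'.2 q m) hr hx fun j => ?_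
    obtain ⟨c, hc, rfl⟩ := exists_position_eq q.1.1 j
    refine e.symm.injective (funext fun k => ?_)
    have := congrFun (hZ c (hqg ▸ hc)) (.inr (⟨q, hc⟩, m, k))
    rwa [pLFR_place_inr, pLFR_place_inr] at this
  funext ⟨T, b⟩
  rw [← hd]
  by_cases hT : Disjoint g.1 T.1
  swap
  · exact linComb_congr _ (hW T hT b)
  -- In the signal for g ∪ T, all summands except that of (g, T) agree on both sides and cancel.
  have hsum := congrFun hX (.inl (KeyIx.union ⟨(g, T), hT⟩, b))
  rw [pLFR_send_inl, pLFR_send_inl, ← Finset.add_sum_erase _ _ (Finset.mem_univ (g, T)),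
    ← Finset.add_sum_erase (Finset.univ) _ (Finset.mem_univ (g, T)),
    Finset.sum_congr rfl (g := fun q : Sub C r × Sub C t =>
      if q.1.1 ⊆ (KeyIx.union ⟨(g, T), hT⟩).1 ∧ q.2.1 = (KeyIx.union ⟨(g, T), hT⟩).1 \ q.1.1 then
        linComb (d' q.1 + ρ'.1 q.1) W' (q.2, b) else 0) ?_, add_left_inj] at hsum
  · have hc : g.1 ⊆ (KeyIx.union ⟨(g, T), hT⟩).1 ∧ T.1 = (KeyIx.union ⟨(g, T), hT⟩).1 \ g.1 := by
      refine ⟨Finset.subset_union_left, ?_⟩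
      simp only [KeyIx.union]
      rw [Finset.union_sdiff_cancel_left hT]
    rw [if_pos hc, if_pos hc, linComb_add, linComb_add,
      congrFun (hkey ⟨(g, T), hT⟩ rfl) b, add_left_inj, ← hd] at hsum
    exact hsum
  · rintro ⟨h, T'⟩ hh
    by_cases hc : h.1 ⊆ (KeyIx.union ⟨(g, T), hT⟩).1 ∧
        T'.1 = (KeyIx.union ⟨(g, T), hT⟩).1 \ h.1
    · rw [if_pos hc, if_pos hc, hq]
      refine linComb_congr _ (hW T' (fun hdis => ?_) b)
      rw [hc.2] at hdis
      -- An uncached subfile S \ h would miss g, forcing g ⊆ h and, by cardinality, h = g.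
      have hgh : g.1 ⊆ h.1 := by
        intro c hcg
        by_contra hch
        exact Finset.disjoint_left.1 hdis hcg
          (Finset.mem_sdiff.2 ⟨Finset.mem_union_left _ hcg, hch⟩)
      have hgh' : g = h := Subtype.ext (Finset.eq_of_subset_of_card_le hgh (by rw [g.2, h.2]))
      subst hgh'
      refine (Finset.mem_erase.1 hh).1 (Prod.ext rfl (Subtype.ext ?_))
      rw [hc.2]
      exact Finset.union_sdiff_cancel_left hT
    · rw [if_neg hc, if_neg hc]

theorem pLFR_masked (hx : ∀ j, x j ≠ 0) : (pLFR C r N t B e x).Masked := by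
  classical
  intro g W d d' hd
  -- A user other than g has a cache outside g, because both sets have r elements. The compensating
  -- polynomial may be nonzero at that single share. For g itself no compensation is needed and the
  -- witness 0 is a dummy.
  have hcf : ∀ q : KeyIx C r t, ∃ cf : Fin (r - 1) → ShareField r, q.1.1 ≠ g →
      ∀ c ∈ g.1, ∀ hc : c ∈ q.1.1.1, shamirShare 1 cf (x (position q.1.1 c hc)) = 0 := by
    intro q
    by_cases hqg : q.1.1 = g
    · exact ⟨0, fun h => absurd hqg h⟩
    obtain ⟨c₀, hc₀, hc₀g⟩ : ∃ c₀ ∈ q.1.1.1, c₀ ∉ g.1 := by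
      by_contra! h
      exact hqg (Subtype.ext (Finset.eq_of_subset_of_card_le h (by rw [g.2, q.1.1.2])))
    obtain ⟨cf, hcf⟩ := exists_shamirShare_one_eq_zero hx (position q.1.1 c₀ hc₀)
    refine ⟨cf, fun _ c hcg hc => hcf _ fun h => ?_⟩
    exact hc₀g (position_injective _ _ _ h ▸ hcg)
  choose cf hcf using hcf
  let P' (P : Sub C r → Fin N → ZMod 2) : Sub C r → Fin N → ZMod 2 := P + (d - d')
  -- The translation of the coefficients depends on W and P but not on the coefficients, so this
  -- shear is bijective.
  let σ : Equiv.Perm (PrivacyRand C r N t B) :=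
    Equiv.prodShear (Equiv.addRight (d - d')) fun P => Equiv.addRight fun q m k =>
      (keySymbol e (P' P) W q m - keySymbol e P W q m) * cf q k
  refine ⟨σ, ?_⟩
  rintro ⟨P, a⟩
  have hq : ∀ h, d' h + P' P h = d h + P h := fun h => by
    simp only [P', Pi.add_apply, Pi.sub_apply]
    abel
  refine ⟨funext ?_, fun c hcg => funext ?_⟩
  · rintro (⟨S, b⟩ | ⟨h, n⟩)
    · refine (pLFR_send_inl (P' P, _) d' W S b).trans
        (.trans ?_ (pLFR_send_inl (P, a) d W S b).symm)
      simp only [hq]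
    · exact (pLFR_send_inr (P' P, _) d' W h n).trans
        ((congrFun (hq h) n).trans (pLFR_send_inr (P, a) d W h n).symm)
  · rintro (⟨n, T, b⟩ | ⟨q, m, k⟩)
    · rfl
    · have key := shamirShare_add_mul (keySymbol e P W q.1 m) (keySymbol e (P' P) W q.1 m)
        (a q.1 m) (cf q.1) (x (position q.1.1.1 c q.2))
      have hz : (keySymbol e (P' P) W q.1 m - keySymbol e P W q.1 m) *
          shamirShare 1 (cf q.1) (x (position q.1.1.1 c q.2)) = 0 := by
        -- The own key is unchanged because d and d' agree at g; for any other key the visible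
        -- correction vanishes.
        by_cases hqg : q.1.1.1 = g
        · have : P' P q.1.1.1 = P q.1.1.1 := by
            simp only [P', Pi.add_apply, Pi.sub_apply, hqg, hd, sub_self, add_zero]
          simp only [keySymbol, this, sub_self, zero_mul]
        · rw [hcf q.1 hqg c hcg q.2, mul_zero]
      rw [hz, add_zero] at key
      exact (pLFR_place_inr (σ (P, a)) W c q m k).trans ((congrFun (congrArg e.symm key) k).trans
        (pLFR_place_inr (P, a) W c q m k).symm)

end PLFR

/-! ### Sizes of the caches and of the signal -/

theorem natCard_sub (C k : ℕ) : Nat.card (Sub C k) = C.choose k := by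
  rw [Nat.card_eq_fintype_card, Fintype.card_finset_len, Fintype.card_fin]

theorem natCard_sub_disjoint {C : ℕ} (k : ℕ) (g : Finset (Fin C)) :
    Nat.card {T : Sub C k // Disjoint g T.1} = (C - g.card).choose k := by
  have E : {T : Sub C k // Disjoint g T.1} ≃ {T : Finset (Fin C) // T ∈ gᶜ.powersetCard k} :=
    (Equiv.subtypeSubtypeEquivSubtypeInter _ _).trans <| Equiv.subtypeEquivRight fun T => by
      rw [Finset.mem_powersetCard, Finset.subset_compl_iff_disjoint_left, and_comm]
  rw [Nat.card_congr E, Nat.card_eq_fintype_card, Fintype.card_coe, Finset.card_powersetCard,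
    Finset.card_compl, Fintype.card_fin]

theorem natCard_sub_mem_add {C : ℕ} (k : ℕ) (c : Fin C) :
    Nat.card {T : Sub C k // c ∈ T.1} + (C - 1).choose k = C.choose k := by
  classical
  have h := natCard_sub_disjoint k ({c} : Finset (Fin C))
  simp only [Finset.disjoint_singleton_left, Finset.card_singleton] at h
  rw [← h, ← natCard_sub, ← Nat.card_sum]
  exact Nat.card_congr (Equiv.sumCompl _)

theorem natCard_sub_mem {C k : ℕ} (hk : 0 < k) (c : Fin C) :
    Nat.card {T : Sub C k // c ∈ T.1} = (C - 1).choose (k - 1) := by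
  have h := natCard_sub_mem_add k c
  obtain ⟨k, rfl⟩ := Nat.exists_eq_succ_of_ne_zero hk.ne'
  obtain ⟨n, rfl⟩ := Nat.exists_eq_succ_of_ne_zero (c.pos.ne')
  simp only [Nat.succ_eq_add_one, Nat.add_sub_cancel, Nat.choose_succ_succ'] at h ⊢
  omega

/-- A cache lies in a fraction k / C of all k-subsets, which yields the term N t / C. The case k = 0
is separate because of the truncated k - 1. -/
theorem natCard_sub_mem_mul {C : ℕ} (k : ℕ) (c : Fin C) :
    Nat.card {T : Sub C k // c ∈ T.1} * C = k * C.choose k := by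
  obtain rfl | hk := Nat.eq_zero_or_pos k
  · have h := natCard_sub_mem_add 0 c
    simp only [Nat.choose_zero_right, Nat.add_eq_right] at h
    rw [h, zero_mul, zero_mul]
  · rw [natCard_sub_mem hk]
    obtain ⟨k, rfl⟩ := Nat.exists_eq_succ_of_ne_zero hk.ne'
    obtain ⟨n, rfl⟩ := Nat.exists_eq_succ_of_ne_zero (c.pos.ne')
    have := Nat.add_one_mul_choose_eq n k
    simp only [Nat.succ_eq_add_one, Nat.add_sub_cancel] at this ⊢
    rw [mul_comm, this, mul_comm]

theorem natCard_keyIx_mem {C r : ℕ} (t : ℕ) (hr : 0 < r) (c : Fin C) :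
    Nat.card {q : KeyIx C r t // c ∈ q.1.1.1} = (C - r).choose t * (C - 1).choose (r - 1) := by
  let E : {q : KeyIx C r t // c ∈ q.1.1.1} ≃
      Σ g : {g : Sub C r // c ∈ g.1}, {T : Sub C t // Disjoint g.1.1 T.1} :=
    { toFun := fun q => ⟨⟨q.1.1.1, q.2⟩, ⟨q.1.1.2, q.1.2⟩⟩
      invFun := fun p => ⟨⟨(p.1.1, p.2.1), p.2.2⟩, p.1.2⟩
      left_inv := fun _ => rfl
      right_inv := fun _ => rfl }
  rw [Nat.card_congr E, Nat.card_sigma]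
  simp only [natCard_sub_disjoint, fun g : {g : Sub C r // c ∈ g.1} => g.1.2]
  rw [Finset.sum_const, Finset.card_univ, ← Nat.card_eq_fintype_card, natCard_sub_mem hr,
    smul_eq_mul, mul_comm]

section PLFR

variable {C r N t B : ℕ} {e : (Fin (symBits r) → ZMod 2) ≃ ShareField r}
  {x : Fin r → ShareField r}

theorem natCard_pLFR_cacheIx (hr : 0 < r) (c : Fin C) :
    Nat.card ((pLFR C r N t B e x).CacheIx c) =
      N * (Nat.card {T : Sub C t // c ∈ T.1} * B) +
        (C - r).choose t * (C - 1).choose (r - 1) * (B ⌈/⌉ symBits r * symBits r) := by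
  change Nat.card ((Fin N × {T : Sub C t // c ∈ T.1} × Fin B) ⊕
      ({q : KeyIx C r t // c ∈ q.1.1.1} × Fin (B ⌈/⌉ symBits r) × Fin (symBits r))) = _
  simp only [Nat.card_sum, Nat.card_prod, natCard_keyIx_mem t hr, Nat.card_fin]

theorem natCard_pLFR_sendIx :
    Nat.card (pLFR C r N t B e x).SendIx = C.choose (t + r) * B + C.choose r * N := by
  change Nat.card ((Sub C (t + r) × Fin B) ⊕ (Sub C r × Fin N)) = _
  simp only [Nat.card_sum, Nat.card_prod, natCard_sub, Nat.card_fin]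

theorem cast_natCard_pLFR_cacheIx (hr : 0 < r) (c : Fin C) :
    (Nat.card ((pLFR C r N t B e x).CacheIx c) : ℝ) =
      (N : ℝ) * t / C * ((C.choose t * B : ℕ) : ℝ) +
        ((C - r).choose t : ℝ) * ((C - 1).choose (r - 1) : ℝ) *
          ((B ⌈/⌉ symBits r : ℕ) * (symBits r : ℝ)) := by
  have hC : (C : ℝ) ≠ 0 := Nat.cast_ne_zero.2 c.pos.ne'
  have h : (Nat.card {T : Sub C t // c ∈ T.1} : ℝ) * C = t * C.choose t :=
    mod_cast natCard_sub_mem_mul t c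
  rw [natCard_pLFR_cacheIx hr]
  push_cast
  rw [add_left_inj]
  field_simp
  linear_combination (N : ℝ) * B * h

theorem cast_natCard_pLFR_sendIx (ht : t + r ≤ C) :
    (Nat.card (pLFR C r N t B e x).SendIx : ℝ) =
      rateP C r t * ((C.choose t * B : ℕ) : ℝ) + (C.choose r : ℝ) * N := by
  have hb : (C.choose t : ℝ) ≠ 0 := Nat.cast_ne_zero.2 (Nat.choose_pos (by omega)).ne'
  rw [natCard_pLFR_sendIx, rateP]
  push_cast
  field_simp

theorem natCeil_div_eq_ceilDiv (B : ℕ) {l : ℕ} (hl : 0 < l) : ⌈(B : ℝ) / l⌉₊ = B ⌈/⌉ l := by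
  refine eq_of_forall_ge_iff fun c => ?_
  rw [Nat.ceil_le, div_le_iff₀ (Nat.cast_pos.2 hl), ceilDiv_le_iff_le_mul hl, mul_comm]
  exact_mod_cast Iff.rfl

theorem natCard_pLFR_cacheIx_eq_memP (hr : 0 < r) (ht : t + r ≤ C) (hB : 0 < B) (c : Fin C) :
    (Nat.card ((pLFR C r N t B e x).CacheIx c) : ℝ) =
      memP C r N (C.choose t * B) t * ((C.choose t * B : ℕ) : ℝ) := by
  have hl := (symBits_spec r).1
  have hb : (C.choose t : ℝ) ≠ 0 := Nat.cast_ne_zero.2 (Nat.choose_pos (by omega)).ne'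
  have hB' : (B : ℝ) ≠ 0 := Nat.cast_ne_zero.2 hB.ne'
  have hceil : ⌈((C.choose t * B : ℕ) : ℝ) / ((symBits r : ℝ) * (C.choose t : ℝ))⌉₊ =
      B ⌈/⌉ symBits r := by
    rw [← natCeil_div_eq_ceilDiv B hl]
    congr 1
    push_cast
    field_simp
  rw [cast_natCard_pLFR_cacheIx hr, memP, hceil]
  push_cast
  field_simp

end PLFR

/-! ### Memory sharing -/

namespace Scheme

variable {C r N : ℕ} {β γ : Type}

/-- The scheme for files whose bits are indexed in a different way. -/
def relabel (s : Scheme C r N β) (f : β ≃ γ) : Scheme C r N γ where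
  Rand := s.Rand
  CacheIx := s.CacheIx
  SendIx := s.SendIx
  finite_rand := inferInstance
  nonempty_rand := inferInstance
  finite_cacheIx := inferInstance
  finite_sendIx := inferInstance
  place c ρ W := s.place c ρ fun n b => W n (f b)
  send ρ d W := s.send ρ d fun n b => W n (f b)

theorem Decodable.relabel {s : Scheme C r N β} (hs : s.Decodable) (f : β ≃ γ) :
    (s.relabel f).Decodable := by
  intro g W W' ρ ρ' d d' hX hd hZ
  funext b
  have := congrFun (hs g _ _ ρ ρ' d d' hX hd hZ) (f.symm b)
  simpa [linComb] using this

theorem Masked.relabel {s : Scheme C r N β} (hs : s.Masked) (f : β ≃ γ) :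
    (s.relabel f).Masked :=
  fun g W d d' hd => hs g (fun n b => W n (f b)) d d' hd

/-- Memory sharing: each file is split into two parts, and two schemes are applied to the parts
with independent randomness. -/
def share (s : Scheme C r N β) (s' : Scheme C r N γ) : Scheme C r N (β ⊕ γ) where
  Rand := s.Rand × s'.Rand
  CacheIx c := s.CacheIx c ⊕ s'.CacheIx c
  SendIx := s.SendIx ⊕ s'.SendIx
  finite_rand := inferInstance
  nonempty_rand := inferInstance
  finite_cacheIx := inferInstance
  finite_sendIx := inferInstance
  place c ρ W := Sum.elim (s.place c ρ.1 fun n b => W n (.inl b))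
    (s'.place c ρ.2 fun n b => W n (.inr b))
  send ρ d W := Sum.elim (s.send ρ.1 d fun n b => W n (.inl b))
    (s'.send ρ.2 d fun n b => W n (.inr b))

theorem Decodable.share {s : Scheme C r N β} {s' : Scheme C r N γ} (hs : s.Decodable)
    (hs' : s'.Decodable) : (s.share s').Decodable := by
  intro g W W' ρ ρ' d d' hX hd hZ
  funext b
  rcases b with b | b
  · exact congrFun (hs g _ _ ρ.1 ρ'.1 d d' (funext fun i => congrFun hX (.inl i)) hd
      fun c hc => funext fun i => congrFun (hZ c hc) (.inl i)) b
  · exact congrFun (hs' g _ _ ρ.2 ρ'.2 d d' (funext fun i => congrFun hX (.inr i)) hd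
      fun c hc => funext fun i => congrFun (hZ c hc) (.inr i)) b

theorem Masked.share {s : Scheme C r N β} {s' : Scheme C r N γ} (hs : s.Masked)
    (hs' : s'.Masked) : (s.share s').Masked := by
  intro g W d d' hd
  obtain ⟨σ, hσ⟩ := hs g (fun n b => W n (.inl b)) d d' hd
  obtain ⟨τ, hτ⟩ := hs' g (fun n b => W n (.inr b)) d d' hd
  refine ⟨σ.prodCongr τ, fun ρ => ⟨?_, fun c hc => ?_⟩⟩
  · exact congrArg₂ Sum.elim (hσ ρ.1).1 (hτ ρ.2).1
  · exact congrArg₂ Sum.elim ((hσ ρ.1).2 c hc) ((hτ ρ.2).2 c hc)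

/-- The scheme which caches nothing and sends all files. -/
def uncoded (C r N : ℕ) (β : Type) [Finite β] : Scheme C r N β where
  Rand := Unit
  CacheIx _ := Empty
  SendIx := Fin N × β
  finite_rand := inferInstance
  nonempty_rand := inferInstance
  finite_cacheIx := inferInstance
  finite_sendIx := inferInstance
  place _ _ _ := Empty.elim
  send _ _ W i := W i.1 i.2

theorem uncoded_decodable [Finite β] : (uncoded C r N β).Decodable := by
  intro g W W' ρ ρ' d d' hX hd _
  have : W = W' := funext fun n => funext fun b => congrFun hX (n, b)
  rw [this, hd]

theorem uncoded_masked [Finite β] : (uncoded C r N β).Masked :=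
  fun _ _ _ _ _ => ⟨Equiv.refl _, fun _ => ⟨rfl, fun _ _ => rfl⟩⟩

/-- The scheme in which every cache stores all files and nothing is sent. -/
def fullyCached (C r N : ℕ) (β : Type) [Finite β] : Scheme C r N β where
  Rand := Unit
  CacheIx _ := Fin N × β
  SendIx := Empty
  finite_rand := inferInstance
  nonempty_rand := inferInstance
  finite_cacheIx := inferInstance
  finite_sendIx := inferInstance
  place _ _ W i := W i.1 i.2
  send _ _ _ := Empty.elim

theorem fullyCached_decodable [Finite β] (hr : 0 < r) : (fullyCached C r N β).Decodable := by
  intro g W W' ρ ρ' d d' _ hd hZ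
  obtain ⟨c, hc⟩ : g.1.Nonempty := Finset.card_pos.1 (g.2.symm ▸ hr)
  have : W = W' := funext fun n => funext fun b => congrFun (hZ c hc) (n, b)
  rw [this, hd]

theorem fullyCached_masked [Finite β] : (fullyCached C r N β).Masked :=
  fun _ _ _ _ _ => ⟨Equiv.refl _, fun _ => ⟨rfl, fun _ _ => rfl⟩⟩

end Scheme

/-- There is a P-LFR scheme for files of `F` bits with caches of at most `m` bits and a signal
of at most `R` bits. -/
def Achievable (C r N F : ℕ) (m R : ℝ) : Prop :=
  ∃ s : Scheme C r N (Fin F), s.Decodable ∧ s.Masked ∧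
    (∀ c, (Nat.card (s.CacheIx c) : ℝ) ≤ m) ∧ (Nat.card s.SendIx : ℝ) ≤ R

/-! ### Rounding at the corner points and their convex combinations -/

section Achievable

variable {C r N : ℕ}

theorem achievable_of_scheme {β : Type} [Finite β] (s : Scheme C r N β) (hd : s.Decodable)
    (hm : s.Masked) {F : ℕ} (hF : Nat.card β = F) {m R : ℝ}
    (hc : ∀ c, (Nat.card (s.CacheIx c) : ℝ) ≤ m) (hR : (Nat.card s.SendIx : ℝ) ≤ R) :
    Achievable C r N F m R :=
  ⟨s.relabel (Finite.equivFinOfCardEq hF), hd.relabel _, hm.relabel _, hc, hR⟩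

theorem Achievable.mono {F : ℕ} {m m' R R' : ℝ} (h : Achievable C r N F m R) (hm : m ≤ m')
    (hR : R ≤ R') : Achievable C r N F m' R' := by
  obtain ⟨s, h1, h2, h3, h4⟩ := h
  exact ⟨s, h1, h2, fun c => (h3 c).trans hm, h4.trans hR⟩

theorem Achievable.add {F F' : ℕ} {m m' R R' : ℝ} (h : Achievable C r N F m R)
    (h' : Achievable C r N F' m' R') : Achievable C r N (F + F') (m + m') (R + R') := by
  obtain ⟨s, h1, h2, h3, h4⟩ := h
  obtain ⟨s', h1', h2', h3', h4'⟩ := h'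
  refine achievable_of_scheme (s.share s') (h1.share h1') (h2.share h2') (by simp) (fun c => ?_) ?_
  · change (Nat.card (s.CacheIx c ⊕ s'.CacheIx c) : ℝ) ≤ _
    rw [Nat.card_sum, Nat.cast_add]
    exact add_le_add (h3 c) (h3' c)
  · change (Nat.card (s.SendIx ⊕ s'.SendIx) : ℝ) ≤ _
    rw [Nat.card_sum, Nat.cast_add]
    exact add_le_add h4 h4'

theorem achievable_uncoded (F : ℕ) : Achievable C r N F 0 (N * F) := by
  refine achievable_of_scheme (Scheme.uncoded C r N (Fin F)) Scheme.uncoded_decodable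
    Scheme.uncoded_masked (by simp) (fun c => ?_) ?_
  · change (Nat.card Empty : ℝ) ≤ _
    simp
  · change (Nat.card (Fin N × Fin F) : ℝ) ≤ _
    simp

theorem achievable_fullyCached (hr : 0 < r) (F : ℕ) : Achievable C r N F (N * F) 0 := by
  refine achievable_of_scheme (Scheme.fullyCached C r N (Fin F))
    (Scheme.fullyCached_decodable hr) Scheme.fullyCached_masked (by simp) (fun c => ?_) ?_
  · change (Nat.card (Fin N × Fin F) : ℝ) ≤ _
    simp
  · change (Nat.card Empty : ℝ) ≤ _
    simp

theorem achievable_sum {ι : Type*} (s : Finset ι) {F : ι → ℕ} {m R : ι → ℝ}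
    (h : ∀ i ∈ s, Achievable C r N (F i) (m i) (R i)) :
    Achievable C r N (∑ i ∈ s, F i) (∑ i ∈ s, m i) (∑ i ∈ s, R i) := by
  classical
  induction s using Finset.induction_on with
  | empty => simpa using achievable_uncoded (C := C) (r := r) (N := N) 0
  | insert i s hi ih =>
    rw [Finset.sum_insert hi, Finset.sum_insert hi, Finset.sum_insert hi]
    exact (h i (Finset.mem_insert_self i s)).add
      (ih fun j hj => h j (Finset.mem_insert_of_mem hj))

theorem exists_share_points (r : ℕ) :
    ∃ x : Fin r → ShareField r, Function.Injective x ∧ ∀ j, x j ≠ 0 := by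
  classical
  have hl := symBits_spec r
  let : Fintype (ShareField r) := Fintype.ofFinite _
  have hcard : Fintype.card (ShareField r) = 2 ^ symBits r := by
    rw [← Nat.card_eq_fintype_card]
    exact GaloisField.card 2 _ hl.1.ne'
  have hle : Fintype.card (Fin r) ≤ Fintype.card {y : ShareField r // y ≠ 0} := by
    rw [Fintype.card_fin, Fintype.card_subtype_compl, Fintype.card_subtype_eq, hcard]
    exact Nat.le_sub_one_of_lt hl.2
  obtain ⟨f⟩ := Function.Embedding.nonempty_of_card_le hle
  exact ⟨fun j => (f j).1, Subtype.val_injective.comp f.injective, fun j => (f j).2⟩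

theorem nonempty_symbol_equiv (r : ℕ) :
    Nonempty ((Fin (symBits r) → ZMod 2) ≃ ShareField r) := by
  refine ⟨Classical.choice (Finite.card_eq.1 ?_)⟩
  rw [show Nat.card (ShareField r) = _ from GaloisField.card 2 _ (symBits_spec r).1.ne']
  simp

/-- Subfile lengths divisible by the symbol length need no padding, so the ceiling is exact. -/
theorem achievable_pLFR (hr : 0 < r) {t : ℕ} (ht : t + r ≤ C) (n : ℕ) :
    Achievable C r N (C.choose t * (symBits r * n))
      ((N : ℝ) * t / C * ((C.choose t * (symBits r * n) : ℕ) : ℝ) +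
        ((C - r).choose t : ℝ) * ((C - 1).choose (r - 1) : ℝ) * (n * (symBits r : ℝ)))
      (rateP C r t * ((C.choose t * (symBits r * n) : ℕ) : ℝ) + (C.choose r : ℝ) * N) := by
  obtain ⟨e⟩ := nonempty_symbol_equiv r
  obtain ⟨x, hx, hx0⟩ := exists_share_points r
  refine achievable_of_scheme (pLFR C r N t (symBits r * n) e x) (pLFR_decodable hr hx)
    (pLFR_masked hx0) (by simp) (fun c => ?_) (cast_natCard_pLFR_sendIx ht).le
  rw [cast_natCard_pLFR_cacheIx hr, ← smul_eq_mul (symBits r) n, smul_ceilDiv (symBits_spec r).1]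

/-- A bound on the loss by rounding and on the additional bits of a single corner point. -/
def cornerLoss (C r N : ℕ) : ℝ := 1 + (2 : ℝ) ^ C * symBits r + (C.choose r : ℝ) * N

/-- The share w F is rounded down to a whole number of bits for the two trivial corners, and to a
multiple of l·binom(C, t) for the others. In `cornerLoss`, 1 and 2^C·l bound the rounding and
binom(C, r)·N pays for the vectors d + P. -/
theorem exists_achievable_corner (hr : 0 < r) {F : ℕ} (hF : 0 < F) {y : ℝ × ℝ}
    (hy : y ∈ cornerPoints C r N F) {w : ℝ} (hw : 0 ≤ w) :
    ∃ F' : ℕ, (F' : ℝ) ≤ w * F ∧ w * F - cornerLoss C r N ≤ F' ∧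
      Achievable C r N F' (w * y.1 * F) (w * y.2 * F + cornerLoss C r N) := by
  have hwF : 0 ≤ w * F := by positivity
  have hl1 : 1 ≤ cornerLoss C r N := by
    have : 0 ≤ (2 : ℝ) ^ C * symBits r + (C.choose r : ℝ) * N := by positivity
    rw [cornerLoss]
    linarith
  have hfl := Nat.floor_le hwF
  have hfl' := Nat.lt_floor_add_one (w * F)
  rcases hy with (rfl | ⟨t, ht, rfl⟩) | rfl
  · refine ⟨⌊w * F⌋₊, hfl, by linarith, (achievable_uncoded _).mono (by simp) ?_⟩
    have := mul_le_mul_of_nonneg_left hfl (Nat.cast_nonneg (α := ℝ) N)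
    simp only
    linarith
  · have hb : (0 : ℝ) < C.choose t := Nat.cast_pos.2 (Nat.choose_pos (by omega))
    have hl : (0 : ℝ) < symBits r := Nat.cast_pos.2 (symBits_spec r).1
    have hF' : (0 : ℝ) < F := Nat.cast_pos.2 hF
    set n := ⌊w * F / (symBits r * C.choose t)⌋₊
    have hn : (n : ℝ) ≤ w * F / (symBits r * C.choose t) := Nat.floor_le (by positivity)
    have hn' : w * F / (symBits r * C.choose t) < n + 1 := Nat.lt_floor_add_one _
    have hle : ((C.choose t * (symBits r * n) : ℕ) : ℝ) ≤ w * F := by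
      rw [le_div_iff₀ (by positivity)] at hn
      push_cast
      linarith
    refine ⟨C.choose t * (symBits r * n), hle, ?_, (achievable_pLFR hr ht n).mono ?_ ?_⟩
    · rw [div_lt_iff₀ (by positivity)] at hn'
      have h2 : (C.choose t : ℝ) * symBits r ≤ 2 ^ C * symBits r :=
        mul_le_mul_of_nonneg_right (mod_cast Nat.choose_le_two_pow C t) hl.le
      have h3 : 0 ≤ (C.choose r : ℝ) * N := by positivity
      rw [cornerLoss]
      push_cast
      linarith
    · have h1 : (N : ℝ) * t / C * ((C.choose t * (symBits r * n) : ℕ) : ℝ) ≤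
          N * t / C * (w * F) := mul_le_mul_of_nonneg_left hle (by positivity)
      -- The ceiling in `memP` is scaled by w while n is rounded down, so the memory bound holds
      -- with no additive loss.
      have h2 : (n : ℝ) ≤ w * ⌈(F : ℝ) / ((symBits r : ℝ) * (C.choose t : ℝ))⌉₊ := by
        refine hn.trans ?_
        rw [mul_div_assoc]
        exact mul_le_mul_of_nonneg_left (Nat.le_ceil _) hw
      have h3 : ((C - r).choose t : ℝ) * ((C - 1).choose (r - 1) : ℝ) * (n * (symBits r : ℝ)) ≤
          ((C - r).choose t : ℝ) * ((C - 1).choose (r - 1) : ℝ) *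
            (w * ⌈(F : ℝ) / ((symBits r : ℝ) * (C.choose t : ℝ))⌉₊ * (symBits r : ℝ)) := by
        gcongr
      refine (add_le_add h1 h3).trans (le_of_eq ?_)
      simp only [memP]
      field_simp
    · have h1 : rateP C r t * ((C.choose t * (symBits r * n) : ℕ) : ℝ) ≤ rateP C r t * (w * F) :=
        mul_le_mul_of_nonneg_left hle (by rw [rateP]; positivity)
      have h2 : 0 ≤ 1 + (2 : ℝ) ^ C * symBits r := by positivity
      rw [cornerLoss]
      simp only
      linarith
  · refine ⟨⌊w * F⌋₊, hfl, by linarith, (achievable_fullyCached hr _).mono ?_ ?_⟩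
    · have := mul_le_mul_of_nonneg_left hfl (Nat.cast_nonneg (α := ℝ) N)
      simp only
      linarith
    · simp only [mul_zero, zero_mul, zero_add]
      linarith

theorem exists_finset_cornerPoints (C r N F : ℕ) :
    ∃ s : Finset (ℝ × ℝ), (s : Set (ℝ × ℝ)) = cornerPoints C r N F ∧ s.card ≤ C + 3 := by
  classical
  refine ⟨insert ((0 : ℝ), (N : ℝ)) (insert ((N : ℝ), (0 : ℝ))
    (((Finset.range (C + 1)).filter (· + r ≤ C)).image
      fun t => (memP C r N F t, rateP C r t))), ?_, ?_⟩
  · ext p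
    simp only [cornerPoints, Finset.coe_insert, Finset.coe_image, Finset.coe_filter,
      Finset.mem_range, Set.mem_insert_iff, Set.mem_image, Set.mem_union, Set.mem_ofPred_eq,
      Set.mem_singleton_iff]
    constructor
    · rintro (h | h | ⟨t, ht, rfl⟩)
      · exact .inl (.inl h)
      · exact .inr h
      · exact .inl (.inr ⟨t, ht.2, rfl⟩)
    · rintro ((h | ⟨t, ht, rfl⟩) | h)
      · exact .inl h
      · exact .inr (.inr ⟨t, ⟨by omega, ht⟩, rfl⟩)
      · exact .inr (.inl h)
  · refine (Finset.card_insert_le _ _).trans (Nat.succ_le_succ ?_)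
    refine (Finset.card_insert_le _ _).trans (Nat.succ_le_succ ?_)
    exact (Finset.card_image_le.trans (Finset.card_filter_le _ _)).trans (by simp)

theorem achievable_of_mem_convexHull (hr : 0 < r) {F : ℕ} (hF : 0 < F) {p : ℝ × ℝ}
    (hp : p ∈ convexHull ℝ (cornerPoints C r N F)) :
    Achievable C r N F (p.1 * F)
      (p.2 * F + (C + 3) * ((1 + N) * cornerLoss C r N)) := by
  obtain ⟨s, hs, hcard⟩ := exists_finset_cornerPoints C r N F
  rw [← hs, Finset.mem_convexHull'] at hp
  obtain ⟨w, hw, hw1, hwp⟩ := hp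
  have hk0 : 0 ≤ cornerLoss C r N := by rw [cornerLoss]; positivity
  have hex : ∀ y, ∃ F' : ℕ, y ∈ s → (F' : ℝ) ≤ w y * F ∧ w y * F - cornerLoss C r N ≤ F' ∧
      Achievable C r N F' (w y * y.1 * F) (w y * y.2 * F + cornerLoss C r N) := by
    intro y
    by_cases hy : y ∈ s
    · obtain ⟨F', h⟩ := exists_achievable_corner hr hF (N := N)
        (hs ▸ Finset.mem_coe.2 hy : y ∈ cornerPoints C r N F) (hw y hy)
      exact ⟨F', fun _ => h⟩
    · exact ⟨0, fun h => absurd h hy⟩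
  choose G hG using hex
  have hsumle : ((∑ y ∈ s, G y : ℕ) : ℝ) ≤ F := by
    push_cast
    refine (Finset.sum_le_sum fun y hy => (hG y hy).1).trans ?_
    rw [← Finset.sum_mul, hw1, one_mul]
  have hsumge : (F : ℝ) - s.card * cornerLoss C r N ≤ (∑ y ∈ s, G y : ℕ) := by
    push_cast
    refine le_trans (le_of_eq ?_) (Finset.sum_le_sum fun y hy => (hG y hy).2.1)
    rw [Finset.sum_sub_distrib, ← Finset.sum_mul, hw1, one_mul, Finset.sum_const, nsmul_eq_mul]
  have hle : ∑ y ∈ s, G y ≤ F := by exact_mod_cast hsumle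
  -- Sending the leftover bits uncoded uses no cache and costs N transmitted bits for each bit of
  -- file length. With at most C + 3 corners, each contributing its own loss and N times its
  -- rounding loss, this gives the constant.
  have h := (achievable_sum s fun y hy => (hG y hy).2.2).add
    (achievable_uncoded (C := C) (r := r) (N := N) (F - ∑ y ∈ s, G y))
  rw [Nat.add_sub_cancel' hle, Nat.cast_sub hle] at h
  have h1 : ∑ y ∈ s, w y * y.1 = p.1 := by
    rw [← hwp, Prod.fst_sum]
    simp
  have h2 : ∑ y ∈ s, w y * y.2 = p.2 := by
    rw [← hwp, Prod.snd_sum]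
    simp
  refine h.mono ?_ ?_
  · rw [← Finset.sum_mul, h1, add_zero]
  · rw [Finset.sum_add_distrib, ← Finset.sum_mul, h2, Finset.sum_const, nsmul_eq_mul, add_assoc]
    have h3 : (N : ℝ) * (F - (∑ y ∈ s, G y : ℕ)) ≤ N * (s.card * cornerLoss C r N) :=
      mul_le_mul_of_nonneg_left (by linarith) N.cast_nonneg
    have h4 : (s.card : ℝ) * ((1 + N) * cornerLoss C r N) ≤
        (C + 3) * ((1 + N) * cornerLoss C r N) :=
      mul_le_mul_of_nonneg_right (mod_cast hcard) (by positivity)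
    linarith

end Achievable

end MultiAccess

end

theorem theorem2 (C r N : ℕ) (hr : 0 < r) (hrC : r ≤ C) :
    (∀ t B : ℕ, t + r ≤ C → 0 < B →
      ∀ (e : (Fin (MultiAccess.symBits r) → ZMod 2) ≃ MultiAccess.ShareField r)
        (x : Fin r → MultiAccess.ShareField r), Function.Injective x → (∀ j, x j ≠ 0) →
        (MultiAccess.pLFR C r N t B e x).IsPLFR ∧
        (∀ c, (Nat.card ((MultiAccess.pLFR C r N t B e x).CacheIx c) : ℝ) =
          MultiAccess.memP C r N (C.choose t * B) t * ((C.choose t * B : ℕ) : ℝ)) ∧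
        (Nat.card (MultiAccess.pLFR C r N t B e x).SendIx : ℝ) =
          MultiAccess.rateP C r t * ((C.choose t * B : ℕ) : ℝ) + (C.choose r : ℝ) * N) ∧
    (∃ κ : ℝ, ∀ F : ℕ, 0 < F →
      ∀ M ∈ Prod.fst '' convexHull ℝ (MultiAccess.cornerPoints C r N F),
        ∃ s : MultiAccess.Scheme C r N (Fin F), s.IsPLFR ∧
          (∀ c, (Nat.card (s.CacheIx c) : ℝ) ≤ M * F) ∧
          (Nat.card s.SendIx : ℝ) ≤
            MultiAccess.lowerConvexEnvelope (MultiAccess.cornerPoints C r N F) M * F + κ) := by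
  refine ⟨fun t B ht hB e x hx hx0 => ?_, ?_⟩
  · exact ⟨MultiAccess.Scheme.isPLFR_of_decodable_of_masked
      (MultiAccess.pLFR_decodable hr hx) (MultiAccess.pLFR_masked hx0),
      MultiAccess.natCard_pLFR_cacheIx_eq_memP hr ht hB,
      MultiAccess.cast_natCard_pLFR_sendIx ht⟩
  · refine ⟨(C + 3) * ((1 + N) * MultiAccess.cornerLoss C r N) + 1, fun F hF M hM => ?_⟩
    obtain ⟨p, hp, rfl⟩ := hM
    have hF' : (0 : ℝ) < F := Nat.cast_pos.2 hF
    -- Approximating the infimum within 1 / F costs at most one bit, the final 1 in κ, and avoids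
    -- showing that it is attained.
    obtain ⟨R, hR, hlt⟩ := Real.lt_sInf_add_pos
      (s := {R : ℝ | (p.1, R) ∈ convexHull ℝ (MultiAccess.cornerPoints C r N F)}) ⟨p.2, hp⟩
      (one_div_pos.2 hF')
    obtain ⟨s, hd, hm, hc, hs⟩ := MultiAccess.achievable_of_mem_convexHull hr hF hR
    refine ⟨s, MultiAccess.Scheme.isPLFR_of_decodable_of_masked hd hm, hc, hs.trans ?_⟩
    have hRF := mul_le_mul_of_nonneg_right hlt.le hF'.le
    rw [add_mul, one_div, inv_mul_cancel₀ hF'.ne'] at hRF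
    rw [MultiAccess.lowerConvexEnvelope]
    linarith
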